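/- Let $q$ be a prime power and $k\ge 8$ an integer, and let $e_1,\dots,e_k$ be the standard basis of $\mathbf F_q^k$. For $f\in\mathbf F_q$ put $U_{1,f}=\langle e_1+fe_2,\ e_3+fe_4\rangle$ and $U_{2,f}=\langle e_5+fe_6,\ e_7+fe_8\rangle$; these are $2q$ two-dimensional subspaces of $\mathbf F_q^k$ meeting pairwise only in $0$. Let $U$ be the set of nonzero vectors of $\mathbf F_q^k$ lying in none of these $2q$ subspaces. Pick exactly one vector from each class $\{\lambda v:\lambda\in\mathbf F_q^*\}$, $v\in U$, let $\widetilde G$ be a matrix having the picked vectors as its columns, and let $\mathbf C_2=\{a\widetilde G: a\in\mathbf F_q^k\}$. Such a $\widetilde G$ exists, and for every such choice $\mathbf C_2$ is a linear $[n,k,d]_q$ code with $$n=\frac{(q^k-1)-2q(q^2-1)}{q-1},\qquad d=q^{k-1}-2q^2,$$ and it is optimal, that is, there is no linear $[n,k,d+1]_q$ code. Moreover: (a) The weight distribution of $\mathbf C_2$ is given by the following table, where for each $w$ the number of codewords of Hamming weight $w$ is the sum of the multiplicities in all rows whose weight equals $w$, and is $0$ if there is no such row. (Two rows have the same weight only when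 $q=2$, namely the rows $q^{k-1}-q^2$ and $q^{k-1}-2q^2+2q$.) $$\begin{array}{c|c} \text{weight}&\text{multiplicity}\\ \hline 0&1\\ q^{k-1}&q^{k-8}-1\\ q^{k-1}-q^2+q&2q(q^2-1)q^{k-8}\\ q^{k-1}-q^2&2(q^4-q^3+q-1)q^{k-8}\\ q^{k-1}-2q^2+2q&(q^2-1)^2q^{k-6}\\ q^{k-1}-2q^2+q&2q(q^2-1)(q^4-q^3+q-1)q^{k-8}\\ q^{k-1}-2q^2&(q^4-q^3+q-1)^2q^{k-8} \end{array}$$ (b) For $1\le r\le k$ let $d_r(\mathbf C_2)$ be the $r$-th generalized Hamming weight, i.e. the minimum, over the $r$-dimensional subcodes $D$ of $\mathbf C_2$, of the number of coordinate positions in which some codeword of $D$ is nonzero. Then $d_1(\mathbf C_2)=q^{k-1}-2q^2$ and, for $2\le r\le k$, $$d_r(\mathbf C_2)=\frac{(q^k-q^{k-r})-2q(q^2-1)}{q-1}.$$ -/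

import Mathlib

/-- The vector `e_j` of `F^k` (coordinates numbered from `1`): `1` in position `j`, `0` elsewhere.
It is used only for `1 ≤ j ≤ k`. -/
def unitVec (F : Type*) [Field F] (k j : ℕ) : Fin k → F :=
  fun i => if (i : ℕ) + 1 = j then 1 else 0

/-- The `2q` subspaces `U_1, …, U_{2q}` of `F^k`, indexed by two copies of the field `F`:
`⟨e_1 + f e_2, e_3 + f e_4⟩` for `f` in the first copy and
`⟨e_5 + f e_6, e_7 + f e_8⟩` for `f` in the second copy. -/
def removedSpace (F : Type*) [Field F] (k : ℕ) : F ⊕ F → Submodule F (Fin k → F)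
  | Sum.inl f => Submodule.span F
      {unitVec F k 1 + f • unitVec F k 2, unitVec F k 3 + f • unitVec F k 4}
  | Sum.inr f => Submodule.span F
      {unitVec F k 5 + f • unitVec F k 6, unitVec F k 7 + f • unitVec F k 8}

/-- The set `U` of the nonzero vectors of `F^k` that lie in none of the subspaces `U_i`. -/
def remainingVectors (F : Type*) [Field F] (k : ℕ) : Set (Fin k → F) :=
  {v | v ≠ 0 ∧ ∀ s, v ∉ removedSpace F k s}

/-- `G` is a matrix whose columns are obtained by picking exactly one vector from each class
`{λ v | λ ∈ F, λ ≠ 0}`, `v ∈ U`, in some order. -/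
structure PicksRepresentatives {F : Type*} [Field F] {k n : ℕ}
    (G : Matrix (Fin k) (Fin n) F) : Prop where
  col_mem : ∀ j : Fin n, (fun i => G i j) ∈ remainingVectors F k
  existsUnique_col : ∀ v ∈ remainingVectors F k,
    ∃! j : Fin n, ∃ c : F, c ≠ 0 ∧ v = c • (fun i => G i j)

/-- The linear code with generator matrix `G`: all vectors `a G`, `a ∈ F^k`. -/
def codeOf {F : Type*} [Field F] {k n : ℕ} (G : Matrix (Fin k) (Fin n) F) :
    Submodule F (Fin n → F) :=
  LinearMap.range G.vecMulLinear

/-- The minimum distance of a linear code (`0` if the code has only one codeword). -/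
noncomputable def minDist {F : Type*} [Field F] [DecidableEq F] {n : ℕ}
    (C : Submodule F (Fin n → F)) : ℕ :=
  sInf {d | ∃ a ∈ C, ∃ b ∈ C, a ≠ b ∧ hammingDist a b = d}

/-- `C` is a linear `[n, k, d]` code over `F`. -/
def IsLinearCode {F : Type*} [Field F] [DecidableEq F] {n : ℕ}
    (C : Submodule F (Fin n → F)) (k d : ℕ) : Prop :=
  Module.finrank F C = k ∧ minDist C = d

/-- A linear `[n, k, d]` code is optimal if there is no linear `[n, k, d + 1]` code over the same
field. -/
def IsOptimalCode {F : Type*} [Field F] [DecidableEq F] {n : ℕ}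
    (C : Submodule F (Fin n → F)) : Prop :=
  ¬ ∃ C' : Submodule F (Fin n → F), IsLinearCode C' (Module.finrank F C) (minDist C + 1)

/-- The number `A_w(C)` of codewords of Hamming weight `w` in `C`. -/
noncomputable def weightCount {F : Type*} [Field F] [DecidableEq F] {n : ℕ}
    (C : Submodule F (Fin n → F)) (w : ℕ) : ℕ :=
  {c : Fin n → F | c ∈ C ∧ hammingNorm c = w}.ncard

/-- The support of a code: the positions in which some codeword is nonzero. -/
def codeSupport {F : Type*} [Field F] {n : ℕ} (D : Submodule F (Fin n → F)) : Set (Fin n) :=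
  {i | ∃ a ∈ D, a i ≠ 0}

/-- The `r`-th generalized Hamming weight `d_r(C)`, for `1 ≤ r ≤ dim C`: the least size of the
support of an `r`-dimensional subcode of `C`. -/
noncomputable def genHammingWeight {F : Type*} [Field F] {n : ℕ}
    (C : Submodule F (Fin n → F)) (r : ℕ) : ℕ :=
  sInf {m | ∃ D : Submodule F (Fin n → F),
    D ≤ C ∧ Module.finrank F D = r ∧ (codeSupport D).ncard = m}

/-! Every parameter comes from one count. A column misses the support of the subcode `{aG : a ∈ W}`
exactly when it lies in `W^⊥`. Each column stands for `q - 1` vectors, and the `2q` removed planes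
`U_s` meet pairwise only in `0`, so for `dim W = r` `(q - 1) |supp| = q^k - q^(k-r) - 2q^3 + ∑_s
|U_s ∩ W^⊥|` (`PicksRepresentatives.ncard_codeSupport`).

Weights: for `W = ⟨a⟩`, `a ≠ 0`, a plane contributes `q^2` if it is orthogonal to `a` and `q`
otherwise, so the weight is `q^(k-1) - 2q^2 + qN` with `N` the number of planes orthogonal to `a`.
`N` is a sum over two blocks of four coordinates. In each block it counts the common roots `f` of
two affine polynomials: `q` if the block is zero, at most one otherwise. Double counting gives its
distribution (`sum_comp_commonZeros`), and combining the two blocks gives the table.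

Generalized weights: the sum is least when every intersection is `0`. This is attainable for `r ≥
2`, but not for `r = 1`, where a hyperplane meets every plane nontrivially.

Optimality: for minimum distance `d + 1` the Griesmer bound requires length at least `n + 1`
(`lt_sum_ceilDiv`). -/

/-! ### The Griesmer bound -/

section Griesmer

open Finset

/-- The **Griesmer bound**, for a family of linear functionals `ℓ i`, `i ∈ S`, playing the role of
the coordinate positions: if every nonzero vector has weight at least `d`, then
`∑_{i < dim V} ⌈d / q ^ i⌉ ≤ |S|`. -/
theorem griesmer_bound {F : Type*} [Field F] [Fintype F] [DecidableEq F] {ι : Type*}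
    [DecidableEq ι] (m : ℕ) :
    ∀ {V : Type*} [AddCommGroup V] [Module F V] [Module.Finite F V]
      (_ : Module.finrank F V = m) (ℓ : ι → Module.Dual F V) (S : Finset ι) (d : ℕ)
      (_ : ∀ v : V, v ≠ 0 → d ≤ #{i ∈ S | ℓ i v ≠ 0}),
      ∑ i ∈ range m, d ⌈/⌉ Fintype.card F ^ i ≤ #S := by
  induction m with
  | zero => intros; simp
  | succ m ih =>
    intro V _ _ _ hV ℓ S d hd
    have hq : 0 < Fintype.card F := Fintype.card_pos
    have : Nontrivial V := Module.nontrivial_of_finrank_pos (R := F) (by omega)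
    obtain ⟨v₁, hv₁⟩ := exists_ne (0 : V)
    let P : ℕ → Prop := fun w => ∃ v : V, v ≠ 0 ∧ #{i ∈ S | ℓ i v ≠ 0} = w
    have hP : ∃ w, P w := ⟨_, v₁, hv₁, rfl⟩
    classical
    obtain ⟨v₀, hv₀, hw⟩ := Nat.find_spec hP
    set w := Nat.find hP with hwdef
    have hmin : ∀ v : V, v ≠ 0 → w ≤ #{i ∈ S | ℓ i v ≠ 0} :=
      fun v hv => Nat.find_min' hP ⟨v, hv, rfl⟩
    have hdw : d ≤ w := hw ▸ hd v₀ hv₀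
    obtain ⟨V', hV'⟩ := Submodule.exists_isCompl (Submodule.span F {v₀})
    have hfin : Module.finrank F V' = m := by
      have := Submodule.finrank_add_eq_of_isCompl hV'
      rw [finrank_span_singleton hv₀] at this
      omega
    -- Residual code: on the positions where the minimum weight vector `v₀` vanishes, nonzero
    -- vectors of a complement of `⟨v₀⟩` keep weight at least `w / q`. This follows by averaging the
    -- weights of `v + c v₀` over all `c`.
    have key : ∀ v : V', v ≠ 0 →
        w ⌈/⌉ Fintype.card F ≤ #{i ∈ {i ∈ S | ℓ i v₀ = 0} | (ℓ i ∘ₗ V'.subtype) v ≠ 0} := by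
      intro v hv
      have hne : ∀ c : F, (v : V) + c • v₀ ≠ 0 := by
        intro c h
        refine hv (Subtype.ext ?_)
        refine (Submodule.disjoint_def.1 hV'.disjoint) v ?_ v.2
        rw [eq_neg_of_add_eq_zero_left h]
        exact neg_mem (Submodule.smul_mem _ _ (Submodule.mem_span_singleton_self v₀))
      have hsum : Fintype.card F * w ≤
          ∑ c : F, #{i ∈ S | ℓ i ((v : V) + c • v₀) ≠ 0} := by
        rw [← smul_eq_mul, ← Finset.card_univ]
        exact Finset.card_nsmul_le_sum _ _ _ fun c _ => hmin _ (hne c)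
      -- A position with `ℓ i v₀ ≠ 0` is killed by exactly one `c`; at the other positions `c` plays
      -- no role.
      have hcount : ∀ i, #{c : F | ℓ i ((v : V) + c • v₀) ≠ 0} + (if ℓ i v₀ ≠ 0 then 1 else 0) =
          Fintype.card F * (if ℓ i v₀ = 0 ∧ ℓ i v ≠ 0 then 1 else 0)
            + Fintype.card F * (if ℓ i v₀ ≠ 0 then 1 else 0) := by
        intro i
        by_cases h0 : ℓ i v₀ = 0
        · by_cases h1 : ℓ i v = 0 <;> simp [h0, h1]
        · have : ({c : F | ℓ i ((v : V) + c • v₀) ≠ 0} : Finset F)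
              = univ.erase (-(ℓ i v) / ℓ i v₀) := by
            ext c
            simp only [map_add, map_smul, smul_eq_mul, mem_filter, mem_univ, true_and, mem_erase,
              and_true, ne_eq, eq_div_iff h0]
            rw [not_iff_not, add_comm, add_eq_zero_iff_eq_neg]
          rw [this, card_erase_of_mem (mem_univ _), Finset.card_univ]
          simp [h0]
          omega
      have hswap : ∑ c : F, #{i ∈ S | ℓ i ((v : V) + c • v₀) ≠ 0} + w =
          Fintype.card F * #{i ∈ {i ∈ S | ℓ i v₀ = 0} | (ℓ i ∘ₗ V'.subtype) v ≠ 0}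
            + Fintype.card F * w := by
        have e1 : ∑ c : F, #{i ∈ S | ℓ i ((v : V) + c • v₀) ≠ 0} =
            ∑ i ∈ S, #{c : F | ℓ i ((v : V) + c • v₀) ≠ 0} := by
          simp only [card_filter]
          exact sum_comm
        rw [e1, filter_filter, ← hw, card_filter, card_filter, mul_sum, mul_sum,
          ← sum_add_distrib, ← sum_add_distrib]
        exact sum_congr rfl fun i _ => hcount i
      rw [ceilDiv_le_iff_le_mul hq]
      omega
    have hrec := ih hfin (fun i => ℓ i ∘ₗ V'.subtype) _ _ key
    have hcard : #{i ∈ S | ℓ i v₀ = 0} + w = #S := by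
      rw [← hw]
      exact card_filter_add_card_filter_not _
    rw [sum_range_succ']
    have hle : ∑ i ∈ range m, d ⌈/⌉ Fintype.card F ^ (i + 1) ≤
        ∑ i ∈ range m, (w ⌈/⌉ Fintype.card F) ⌈/⌉ Fintype.card F ^ i := by
      refine sum_le_sum fun i _ => ?_
      rw [ceilDiv_le_iff_le_mul (pow_pos hq _), pow_succ, mul_comm (_ ^ i), mul_assoc,
        ← ceilDiv_le_iff_le_mul hq]
      exact ((ceilDiv_le_iff_le_mul hq).2 (hdw.trans (le_smul_ceilDiv hq))).trans
        (le_smul_ceilDiv (pow_pos hq _))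
    have h0 : d ⌈/⌉ Fintype.card F ^ 0 = d := by simp
    omega

end Griesmer

/-! ### The removed planes and the count of columns outside a subspace -/

section RemovedSpaces

variable {F : Type*} [Field F] {k : ℕ}

theorem unitVec_succ (j : ℕ) (hj : j < k) : unitVec F k (j + 1) = Pi.single ⟨j, hj⟩ 1 := by
  ext i
  simp [unitVec, Pi.single_apply, Fin.ext_iff]

theorem mem_removedSpace_inl (hk : 8 ≤ k) {f : F} {v : Fin k → F}
    (hv : v ∈ removedSpace F k (Sum.inl f)) :
    v = v ⟨0, by omega⟩ • (unitVec F k 1 + f • unitVec F k 2)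
        + v ⟨2, by omega⟩ • (unitVec F k 3 + f • unitVec F k 4) ∧
      v ⟨1, by omega⟩ = v ⟨0, by omega⟩ * f ∧ v ⟨3, by omega⟩ = v ⟨2, by omega⟩ * f ∧
      v ⟨4, by omega⟩ = 0 ∧ v ⟨6, by omega⟩ = 0 := by
  obtain ⟨x, y, rfl⟩ := Submodule.mem_span_pair.1 hv
  simp [unitVec]

theorem mem_removedSpace_inr (hk : 8 ≤ k) {f : F} {v : Fin k → F}
    (hv : v ∈ removedSpace F k (Sum.inr f)) :
    v = v ⟨4, by omega⟩ • (unitVec F k 5 + f • unitVec F k 6)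
        + v ⟨6, by omega⟩ • (unitVec F k 7 + f • unitVec F k 8) ∧
      v ⟨5, by omega⟩ = v ⟨4, by omega⟩ * f ∧ v ⟨7, by omega⟩ = v ⟨6, by omega⟩ * f ∧
      v ⟨0, by omega⟩ = 0 ∧ v ⟨2, by omega⟩ = 0 := by
  obtain ⟨x, y, rfl⟩ := Submodule.mem_span_pair.1 hv
  simp [unitVec]

theorem eq_zero_of_mem_inl (hk : 8 ≤ k) {f : F} {v : Fin k → F}
    (hv : v ∈ removedSpace F k (Sum.inl f)) (h0 : v ⟨0, by omega⟩ = 0)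
    (h2 : v ⟨2, by omega⟩ = 0) : v = 0 := by
  rw [(mem_removedSpace_inl hk hv).1, h0, h2]
  simp

theorem eq_zero_of_mem_inr (hk : 8 ≤ k) {f : F} {v : Fin k → F}
    (hv : v ∈ removedSpace F k (Sum.inr f)) (h0 : v ⟨4, by omega⟩ = 0)
    (h2 : v ⟨6, by omega⟩ = 0) : v = 0 := by
  rw [(mem_removedSpace_inr hk hv).1, h0, h2]
  simp

/-- Within a block, a nonzero vector determines `f` as a ratio of coordinates; planes from different
blocks have disjoint coordinate supports. -/
theorem removedSpace_inf_eq_bot (hk : 8 ≤ k) (s t : F ⊕ F) (hst : s ≠ t) :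
    removedSpace F k s ⊓ removedSpace F k t = ⊥ := by
  rw [eq_bot_iff]
  rintro v ⟨hs, ht⟩
  rw [Submodule.mem_bot]
  have cancel : ∀ {x y f g : F}, f ≠ g → y = x * f → y = x * g → x = 0 := by
    intro x y f g hfg h1 h2
    by_contra hx
    exact hfg (mul_left_cancel₀ hx (h1.symm.trans h2))
  rcases s with f | f <;> rcases t with g | g
  · have hfg : f ≠ g := fun h => hst (by rw [h])
    obtain ⟨-, h1, h3, -⟩ := mem_removedSpace_inl hk hs
    obtain ⟨-, h1', h3', -⟩ := mem_removedSpace_inl hk ht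
    exact eq_zero_of_mem_inl hk hs (cancel hfg h1 h1') (cancel hfg h3 h3')
  · obtain ⟨-, -, -, h0, h2⟩ := mem_removedSpace_inr hk ht
    exact eq_zero_of_mem_inl hk hs h0 h2
  · obtain ⟨-, -, -, h0, h2⟩ := mem_removedSpace_inr hk hs
    exact eq_zero_of_mem_inl hk ht h0 h2
  · have hfg : f ≠ g := fun h => hst (by rw [h])
    obtain ⟨-, h1, h3, -⟩ := mem_removedSpace_inr hk hs
    obtain ⟨-, h1', h3', -⟩ := mem_removedSpace_inr hk ht
    exact eq_zero_of_mem_inr hk hs (cancel hfg h1 h1') (cancel hfg h3 h3')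

theorem finrank_removedSpace (hk : 8 ≤ k) (s : F ⊕ F) :
    Module.finrank F (removedSpace F k s) = 2 := by
  rcases s with f | f
  · have hli : LinearIndependent F
        ![unitVec F k 1 + f • unitVec F k 2, unitVec F k 3 + f • unitVec F k 4] := by
      rw [LinearIndependent.pair_iff]
      intro x y h
      have h0 := congrFun h ⟨0, by omega⟩
      have h2 := congrFun h ⟨2, by omega⟩
      simp [unitVec] at h0 h2
      exact ⟨h0, h2⟩
    have := finrank_span_eq_card hli
    rw [Matrix.range_cons_cons_empty] at this
    exact this
  · have hli : LinearIndependent F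
        ![unitVec F k 5 + f • unitVec F k 6, unitVec F k 7 + f • unitVec F k 8] := by
      rw [LinearIndependent.pair_iff]
      intro x y h
      have h0 := congrFun h ⟨4, by omega⟩
      have h2 := congrFun h ⟨6, by omega⟩
      simp [unitVec] at h0 h2
      exact ⟨h0, h2⟩
    have := finrank_span_eq_card hli
    rw [Matrix.range_cons_cons_empty] at this
    exact this

theorem exists_picksRepresentatives [Finite F] :
    ∃ (n : ℕ) (G : Matrix (Fin k) (Fin n) F), PicksRepresentatives G := by
  classical
  let r : Setoid (remainingVectors F k) :=
    { r := fun v w => ∃ c : F, c ≠ 0 ∧ (v : Fin k → F) = c • (w : Fin k → F)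
      iseqv := by
        refine ⟨fun v => ⟨1, one_ne_zero, (one_smul _ _).symm⟩, ?_, ?_⟩
        · rintro v w ⟨c, hc, h⟩
          exact ⟨c⁻¹, inv_ne_zero hc, by rw [h, inv_smul_smul₀ hc]⟩
        · rintro u v w ⟨c, hc, h⟩ ⟨d, hd, h'⟩
          exact ⟨c * d, mul_ne_zero hc hd, by rw [h, h', mul_smul]⟩ }
  obtain ⟨n, ⟨e⟩⟩ := Finite.exists_equiv_fin (Quotient r)
  refine ⟨n, Matrix.of fun i j => (((e.symm j).out : remainingVectors F k) : Fin k → F) i, ?_, ?_⟩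
  · intro j
    exact ((e.symm j).out : remainingVectors F k).2
  · intro v hv
    refine ⟨e (Quotient.mk r ⟨v, hv⟩), ?_, ?_⟩
    · obtain ⟨c, hc, h⟩ := Setoid.symm (Quotient.mk_out (s := r) ⟨v, hv⟩)
      refine ⟨c, hc, ?_⟩
      simpa using h
    · rintro j ⟨c, hc, h⟩
      have : Quotient.mk r ⟨v, hv⟩ = Quotient.mk r (e.symm j).out := Quotient.sound ⟨c, hc, h⟩
      rw [this, Quotient.out_eq, Equiv.apply_symm_apply]

theorem smul_mem_remainingVectors {v : Fin k → F} (hv : v ∈ remainingVectors F k) {c : F}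
    (hc : c ≠ 0) : c • v ∈ remainingVectors F k :=
  ⟨smul_ne_zero hc hv.1, fun s hs => hv.2 s ((Submodule.smul_mem_iff _ hc).1 hs)⟩

/-- Outside a subspace `K`, the chosen columns, the subspace `K` and the removed subspaces
account for all vectors. -/
theorem PicksRepresentatives.card_columns_notMem [Fintype F] (hk : 8 ≤ k) {n : ℕ}
    {G : Matrix (Fin k) (Fin n) F} (hG : PicksRepresentatives G)
    (K : Submodule F (Fin k → F)) :
    (Fintype.card F - 1) * {j : Fin n | (fun i => G i j) ∉ K}.ncard + Nat.card K
        + 2 * Fintype.card F ^ 3 =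
      Fintype.card F ^ k
        + ∑ s, Nat.card ↥(removedSpace F k s ⊓ K) := by
  classical
  -- Pairs of a column outside `K` and a unit correspond bijectively to remaining vectors outside
  -- `K`.
  have h1 : (Fintype.card F - 1) * {j : Fin n | (fun i => G i j) ∉ K}.ncard =
      {v : Fin k → F | v ∈ remainingVectors F k ∧ v ∉ K}.ncard := by
    rw [← Fintype.card_units, ← Nat.card_eq_fintype_card, mul_comm, ← Nat.card_coe_set_eq,
      ← Nat.card_coe_set_eq, ← Nat.card_prod]
    refine Nat.card_congr (Equiv.ofBijective
      (fun p => ⟨(p.2 : F) • (fun i => G i p.1), smul_mem_remainingVectors (hG.col_mem _)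
        p.2.ne_zero, fun h => p.1.2 ((Submodule.smul_mem_iff _ p.2.ne_zero).1 h)⟩) ⟨?_, ?_⟩)
    · rintro ⟨⟨j, hj⟩, c⟩ ⟨⟨j', hj'⟩, c'⟩ h
      simp only [Subtype.mk.injEq] at h
      have hjj : j = j' := (hG.existsUnique_col _ (smul_mem_remainingVectors (hG.col_mem j)
        c.ne_zero)).unique ⟨c, c.ne_zero, rfl⟩ ⟨c', c'.ne_zero, h⟩
      subst hjj
      have := smul_left_injective F (hG.col_mem j).1 h
      simp [Units.ext_iff, this]
    · rintro ⟨v, hv, hvK⟩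
      obtain ⟨j, ⟨c, hc, h⟩, -⟩ := hG.existsUnique_col v hv
      exact ⟨(⟨j, fun hj => hvK (h ▸ K.smul_mem c hj)⟩, Units.mk0 c hc), Subtype.ext h.symm⟩
  have h2 : ∀ s, (((removedSpace F k s : Set (Fin k → F)) \ K).ncard : ℕ)
      + Nat.card ↥(removedSpace F k s ⊓ K) = Fintype.card F ^ 2 := by
    intro s
    rw [← finrank_removedSpace hk s, ← Nat.card_eq_fintype_card, ← Module.natCard_eq_pow_finrank,
      add_comm]
    exact Set.ncard_inter_add_ncard_sdiff_eq_ncard (removedSpace F k s : Set (Fin k → F)) K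
  have h3 : {v : Fin k → F | v ∈ remainingVectors F k ∧ v ∉ K}.ncard
      + ∑ s, ((removedSpace F k s : Set (Fin k → F)) \ K).ncard =
      ((K : Set (Fin k → F))ᶜ).ncard := by
    -- The only common vector of two planes is `0`, which lies in `K` and is thus already removed.
    have hdisj : Pairwise (Function.onFun Disjoint
        fun s => (removedSpace F k s : Set (Fin k → F)) \ K) := by
      intro s t hst
      refine Set.disjoint_left.2 fun v hv hv' => hv.2 ?_
      have : v ∈ removedSpace F k s ⊓ removedSpace F k t := ⟨hv.1, hv'.1⟩
      rw [removedSpace_inf_eq_bot hk s t hst, Submodule.mem_bot] at this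
      rw [this]
      exact K.zero_mem
    have hU : (⋃ s, (removedSpace F k s : Set (Fin k → F)) \ K).ncard =
        ∑ s, ((removedSpace F k s : Set (Fin k → F)) \ K).ncard := by
      rw [← finsum_eq_sum_of_fintype]
      exact Set.ncard_iUnion_of_finite (fun _ => Set.toFinite _) hdisj
    rw [← hU, ← Set.ncard_union_eq]
    · congr 1
      ext v
      simp only [remainingVectors, Set.mem_union, Set.mem_ofPred_eq, Set.mem_iUnion, Set.mem_sdiff,
        SetLike.mem_coe, Set.mem_compl_iff]
      constructor
      · rintro (h | ⟨s, h⟩)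
        exacts [h.2, h.2]
      · intro h
        by_cases hs : ∃ s, v ∈ removedSpace F k s
        · exact Or.inr (hs.imp fun s hs => ⟨hs, h⟩)
        · push Not at hs
          exact Or.inl ⟨⟨fun h0 => h (h0 ▸ K.zero_mem), hs⟩, h⟩
    · refine Set.disjoint_left.2 fun v hv hv' => ?_
      obtain ⟨s, hs⟩ := Set.mem_iUnion.1 hv'
      exact hv.1.2 s hs.1
  have h4 : Nat.card K + ((K : Set (Fin k → F))ᶜ).ncard = Fintype.card F ^ k := by
    have := Set.ncard_add_ncard_compl (K : Set (Fin k → F))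
    rw [Nat.card_fun, Nat.card_eq_fintype_card, Nat.card_fin] at this
    exact this
  have h5 := Finset.sum_congr (rfl : (Finset.univ : Finset (F ⊕ F)) = _) fun s _ => h2 s
  rw [Finset.sum_add_distrib, Finset.sum_const, Finset.card_univ, Fintype.card_sum,
    smul_eq_mul] at h5
  have h6 : 2 * Fintype.card F ^ 3 = (Fintype.card F + Fintype.card F) * Fintype.card F ^ 2 := by
    ring
  omega

end RemovedSpaces

theorem sum_fun_succ {F : Type*} [Fintype F] {M : Type*} [AddCommMonoid M] {n : ℕ} (g : (Fin (n + 1) → F) → M) :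
    ∑ a, g a = ∑ x : F, ∑ b : Fin n → F, g (Fin.cons x b) := by
  rw [← (Fin.consEquiv fun _ => F).sum_comp, Fintype.sum_prod_type]
  rfl

/-! ### Orthogonality, supports of subcodes and the weight formula -/

section Weights

variable {F : Type*} [Field F] {k : ℕ}

open Matrix

/-- The vectors orthogonal to all of `W`, for the dot product on `F ^ k`. -/
noncomputable def dotAnnihilator (W : Submodule F (Fin k → F)) : Submodule F (Fin k → F) :=
  (W.map (dotProductEquiv F (Fin k)).toLinearMap).dualCoannihilator

theorem mem_dotAnnihilator {W : Submodule F (Fin k → F)} {v : Fin k → F} :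
    v ∈ dotAnnihilator W ↔ ∀ a ∈ W, a ⬝ᵥ v = 0 := by
  rw [dotAnnihilator, Submodule.mem_dualCoannihilator]
  simp only [Submodule.mem_map, forall_exists_index, and_imp, forall_apply_eq_imp_iff₂]
  rfl

theorem mem_dotAnnihilator_span_singleton {a v : Fin k → F} :
    v ∈ dotAnnihilator (Submodule.span F {a}) ↔ a ⬝ᵥ v = 0 := by
  rw [mem_dotAnnihilator]
  refine ⟨fun h => h a (Submodule.mem_span_singleton_self a), fun h b hb => ?_⟩
  obtain ⟨c, rfl⟩ := Submodule.mem_span_singleton.1 hb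
  rw [smul_dotProduct, h, smul_zero]

theorem finrank_dotAnnihilator (W : Submodule F (Fin k → F)) :
    Module.finrank F W + Module.finrank F (dotAnnihilator W) = k := by
  have := Subspace.finrank_add_finrank_dualCoannihilator_eq
    (W.map (dotProductEquiv F (Fin k)).toLinearMap)
  rwa [LinearEquiv.finrank_map_eq, Module.finrank_fin_fun] at this

theorem codeSupport_map_vecMulLinear {n : ℕ} (G : Matrix (Fin k) (Fin n) F)
    (W : Submodule F (Fin k → F)) :
    codeSupport (W.map G.vecMulLinear) = {j | (fun i => G i j) ∉ dotAnnihilator W} := by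
  ext j
  simp only [codeSupport, Submodule.mem_map, mem_dotAnnihilator, Set.mem_ofPred_eq]
  push Not
  constructor
  · rintro ⟨_, ⟨a, ha, rfl⟩, h⟩
    exact ⟨a, ha, h⟩
  · rintro ⟨a, ha, h⟩
    exact ⟨_, ⟨a, ha, rfl⟩, h⟩

theorem PicksRepresentatives.ncard_codeSupport [Fintype F] (hk : 8 ≤ k) {n : ℕ}
    {G : Matrix (Fin k) (Fin n) F} (hG : PicksRepresentatives G) {r : ℕ}
    {W : Submodule F (Fin k → F)} (hW : Module.finrank F W = r) :
    (Fintype.card F - 1) * (codeSupport (W.map G.vecMulLinear)).ncard + Fintype.card F ^ (k - r)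
        + 2 * Fintype.card F ^ 3 =
      Fintype.card F ^ k + ∑ s, Nat.card ↥(removedSpace F k s ⊓ dotAnnihilator W) := by
  have h := hG.card_columns_notMem hk (dotAnnihilator W)
  have hr := finrank_dotAnnihilator W
  rwa [← codeSupport_map_vecMulLinear, Module.natCard_eq_pow_finrank (K := F),
    Nat.card_eq_fintype_card, show Module.finrank F (dotAnnihilator W) = k - r by omega] at h

theorem PicksRepresentatives.card_columns [Fintype F] (hk : 8 ≤ k) {n : ℕ}
    {G : Matrix (Fin k) (Fin n) F} (hG : PicksRepresentatives G) :
    (Fintype.card F - 1) * n + 1 + 2 * Fintype.card F ^ 3 =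
      Fintype.card F ^ k + 2 * Fintype.card F := by
  have h := hG.card_columns_notMem hk ⊥
  have h1 : {j : Fin n | (fun i => G i j) ∉ (⊥ : Submodule F (Fin k → F))} = Set.univ :=
    Set.eq_univ_of_forall fun j hj => (hG.col_mem j).1 ((Submodule.mem_bot F).1 hj)
  rw [h1, Set.ncard_univ, Nat.card_eq_fintype_card, Fintype.card_fin] at h
  simp only [inf_bot_eq, Nat.card_unique, Finset.sum_const, Finset.card_univ, Fintype.card_sum,
    smul_eq_mul, mul_one] at h
  omega

/-- Pairing with `a` is a nonzero functional on the plane, so its kernel is a line. -/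
theorem natCard_inf_dotAnnihilator [Fintype F] (P : Submodule F (Fin k → F))
    (hP : Module.finrank F P = 2) (a : Fin k → F) (h : ∃ v ∈ P, a ⬝ᵥ v ≠ 0) :
    Nat.card ↥(P ⊓ dotAnnihilator (Submodule.span F {a})) = Fintype.card F := by
  let φ : Module.Dual F P := (dotProductEquiv F (Fin k) a) ∘ₗ P.subtype
  have hφ : φ ≠ 0 := by
    obtain ⟨v, hv, hav⟩ := h
    exact fun h0 => hav (by simpa [φ] using LinearMap.congr_fun h0 ⟨v, hv⟩)
  have h1 := Module.Dual.finrank_ker_add_one_of_ne_zero hφ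
  have h2 : P ⊓ dotAnnihilator (Submodule.span F {a}) = (LinearMap.ker φ).map P.subtype := by
    ext v
    simp [φ, mem_dotAnnihilator_span_singleton]
    tauto
  rw [h2, Module.natCard_eq_pow_finrank (K := F), Submodule.finrank_map_subtype_eq,
    show Module.finrank F (LinearMap.ker φ) = 1 by omega, pow_one, Nat.card_eq_fintype_card]

theorem hammingNorm_vecMul [DecidableEq F] {n : ℕ} (G : Matrix (Fin k) (Fin n) F) (a : Fin k → F) :
    hammingNorm (a ᵥ* G) = (codeSupport ((Submodule.span F {a}).map G.vecMulLinear)).ncard := by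
  rw [codeSupport_map_vecMulLinear, hammingNorm, ← Set.ncard_coe_finset]
  congr 1
  ext j
  rw [Finset.mem_coe, Finset.mem_filter, Set.mem_ofPred_eq, mem_dotAnnihilator_span_singleton]
  exact ⟨fun h => h.2, fun h => ⟨Finset.mem_univ _, h⟩⟩

variable [Fintype F] [DecidableEq F]

/-- The number of common zeros in `F` of `x₀ + x₁ t` and `x₂ + x₃ t`. -/
def commonZeros (x₀ x₁ x₂ x₃ : F) : ℕ :=
  Finset.card {f : F | x₀ + f * x₁ = 0 ∧ x₂ + f * x₃ = 0}

/-- The number of removed spaces orthogonal to `a`. -/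
def orthogonalCount (hk : 8 ≤ k) (a : Fin k → F) : ℕ :=
  commonZeros (a ⟨0, by omega⟩) (a ⟨1, by omega⟩) (a ⟨2, by omega⟩) (a ⟨3, by omega⟩)
    + commonZeros (a ⟨4, by omega⟩) (a ⟨5, by omega⟩) (a ⟨6, by omega⟩) (a ⟨7, by omega⟩)

theorem natCard_span_pair_inf {p r a : Fin k → F}
    (hP : Module.finrank F (Submodule.span F {p, r}) = 2) :
    Nat.card ↥(Submodule.span F {p, r} ⊓ dotAnnihilator (Submodule.span F {a})) =
      Fintype.card F + if a ⬝ᵥ p = 0 ∧ a ⬝ᵥ r = 0 then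
        Fintype.card F * (Fintype.card F - 1) else 0 := by
  split_ifs with h
  · have : Submodule.span F {p, r} ≤ dotAnnihilator (Submodule.span F {a}) := by
      rw [Submodule.span_le]
      rintro v (rfl | rfl)
      exacts [mem_dotAnnihilator_span_singleton.2 h.1, mem_dotAnnihilator_span_singleton.2 h.2]
    rw [inf_eq_left.2 this, Module.natCard_eq_pow_finrank (K := F), hP, Nat.card_eq_fintype_card]
    obtain ⟨m, hm⟩ : ∃ m, Fintype.card F = m + 1 := ⟨_, (Nat.succ_pred Fintype.card_ne_zero).symm⟩
    rw [hm, Nat.add_sub_cancel]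
    ring
  · refine natCard_inf_dotAnnihilator _ hP a ?_
    by_contra! h'
    exact h ⟨h' p (Submodule.subset_span (by simp)), h' r (Submodule.subset_span (by simp))⟩

theorem sum_natCard_inf (hk : 8 ≤ k) (a : Fin k → F) :
    ∑ s, Nat.card ↥(removedSpace F k s ⊓ dotAnnihilator (Submodule.span F {a})) =
      2 * Fintype.card F ^ 2
        + Fintype.card F * (Fintype.card F - 1) * orthogonalCount hk a := by
  have h1 : ∀ f : F, Nat.card
      ↥(removedSpace F k (Sum.inl f) ⊓ dotAnnihilator (Submodule.span F {a})) = _ :=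
    fun f => natCard_span_pair_inf (finrank_removedSpace hk (Sum.inl f))
  have h2 : ∀ f : F, Nat.card
      ↥(removedSpace F k (Sum.inr f) ⊓ dotAnnihilator (Submodule.span F {a})) = _ :=
    fun f => natCard_span_pair_inf (finrank_removedSpace hk (Sum.inr f))
  have hdot : ∀ (f : F) (i j : ℕ) (hi : i < k) (hj : j < k),
      a ⬝ᵥ (unitVec F k (i + 1) + f • unitVec F k (j + 1)) = a ⟨i, hi⟩ + f * a ⟨j, hj⟩ := by
    intro f i j hi hj
    rw [unitVec_succ i hi, unitVec_succ j hj, dotProduct_add, dotProduct_smul]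
    simp
  rw [Fintype.sum_sum_type]
  simp only [h1, h2, Finset.sum_add_distrib, Finset.sum_const, Finset.card_univ, smul_eq_mul]
  simp only [← Finset.sum_filter, Finset.sum_const, smul_eq_mul]
  rw [orthogonalCount, commonZeros, commonZeros]
  simp only [← hdot]
  ring

theorem PicksRepresentatives.hammingNorm_eq (hk : 8 ≤ k) {n : ℕ}
    {G : Matrix (Fin k) (Fin n) F} (hG : PicksRepresentatives G) {a : Fin k → F} (ha : a ≠ 0) :
    hammingNorm (a ᵥ* G) + 2 * Fintype.card F ^ 2 =
      Fintype.card F ^ (k - 1) + Fintype.card F * orthogonalCount hk a := by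
  have h := hG.ncard_codeSupport hk (finrank_span_singleton (K := F) ha)
  rw [← hammingNorm_vecMul, sum_natCard_inf hk] at h
  obtain ⟨m, hm⟩ : ∃ m, Fintype.card F = m + 2 :=
    ⟨_, (Nat.sub_add_cancel (Fintype.one_lt_card : 1 < Fintype.card F)).symm⟩
  obtain ⟨l, rfl⟩ : ∃ l, k = l + 1 := ⟨k - 1, by omega⟩
  rw [hm] at h ⊢
  simp only [Nat.add_sub_cancel, show m + 2 - 1 = m + 1 by omega] at h ⊢
  refine Nat.eq_of_mul_eq_mul_left (Nat.succ_pos m) ?_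
  rw [pow_succ (m + 2) l] at h
  generalize (m + 2) ^ l = Q at h ⊢
  zify at h ⊢
  linear_combination h

theorem commonZeros_zero : commonZeros (0 : F) 0 0 0 = Fintype.card F := by
  simp [commonZeros]

/-- An affine polynomial with two distinct roots is identically zero. -/
theorem commonZeros_le_one {x₀ x₁ x₂ x₃ : F} (h : ¬(x₀ = 0 ∧ x₁ = 0 ∧ x₂ = 0 ∧ x₃ = 0)) :
    commonZeros x₀ x₁ x₂ x₃ ≤ 1 := by
  rw [commonZeros, Finset.card_le_one]
  intro f hf g hg
  simp only [Finset.mem_filter, Finset.mem_univ, true_and] at hf hg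
  by_contra hfg
  have hfg' : f - g ≠ 0 := sub_ne_zero.2 hfg
  have h1 : x₁ = 0 := (mul_eq_zero.1 (show (f - g) * x₁ = 0 by
    linear_combination hf.1 - hg.1)).resolve_left hfg'
  have h3 : x₃ = 0 := (mul_eq_zero.1 (show (f - g) * x₃ = 0 by
    linear_combination hf.2 - hg.2)).resolve_left hfg'
  subst h1 h3
  exact h ⟨by simpa using hf.1, rfl, by simpa using hf.2, rfl⟩

/-- Double counting: for each `f`, the coordinates `x₁` and `x₃` are free and determine `x₀` and
`x₂`. -/
theorem sum_commonZeros :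
    ∑ x : F × F × F × F, commonZeros x.1 x.2.1 x.2.2.1 x.2.2.2 = Fintype.card F ^ 3 := by
  simp only [commonZeros, Finset.card_filter]
  rw [Finset.sum_comm]
  have : ∀ f : F, ∑ x : F × F × F × F,
      (if x.1 + f * x.2.1 = 0 ∧ x.2.2.1 + f * x.2.2.2 = 0 then 1 else 0) = Fintype.card F ^ 2 := by
    intro f
    rw [← Finset.card_filter, sq, ← Fintype.card_prod, ← Finset.card_univ]
    refine Finset.card_bij' (fun x _ => (x.2.1, x.2.2.2))
      (fun y _ => (-(f * y.1), y.1, -(f * y.2), y.2)) ?_ ?_ ?_ ?_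
    · simp
    · simp
    · rintro ⟨x₀, x₁, x₂, x₃⟩ hx
      simp only [Finset.mem_filter, Finset.mem_univ, true_and] at hx
      simp [eq_neg_of_add_eq_zero_left hx.1, eq_neg_of_add_eq_zero_left hx.2]
    · simp
  rw [Finset.sum_congr rfl fun f _ => this f, Finset.sum_const, Finset.card_univ, smul_eq_mul]
  ring

/-- The value distribution of `commonZeros`. -/
theorem sum_comp_commonZeros (h : ℕ → ℤ) :
    ∑ x₀ : F, ∑ x₁ : F, ∑ x₂ : F, ∑ x₃ : F, h (commonZeros x₀ x₁ x₂ x₃) =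
      h (Fintype.card F)
        + (Fintype.card F : ℤ) * ((Fintype.card F : ℤ) ^ 2 - 1) * h 1
        + ((Fintype.card F : ℤ) ^ 4 - (Fintype.card F : ℤ) ^ 3 + Fintype.card F - 1) * h 0 := by
  have hprod : ∑ x₀ : F, ∑ x₁ : F, ∑ x₂ : F, ∑ x₃ : F, h (commonZeros x₀ x₁ x₂ x₃) =
      ∑ x : F × F × F × F, h (commonZeros x.1 x.2.1 x.2.2.1 x.2.2.2) := by
    simp only [Fintype.sum_prod_type]
  -- Away from `x = 0` the count is `0` or `1`, so `h` may be replaced by its affine interpolation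
  -- there, with a correction at `x = 0`; then only the total `q^3` is needed.
  have hpt : ∀ x : F × F × F × F, h (commonZeros x.1 x.2.1 x.2.2.1 x.2.2.2) =
      (h 0 + commonZeros x.1 x.2.1 x.2.2.1 x.2.2.2 * (h 1 - h 0))
        + if x = 0 then h (Fintype.card F) - h 0 - Fintype.card F * (h 1 - h 0) else 0 := by
    rintro ⟨x₀, x₁, x₂, x₃⟩
    split_ifs with h0
    · simp only [Prod.ext_iff, Prod.fst_zero, Prod.snd_zero] at h0
      obtain ⟨rfl, rfl, rfl, rfl⟩ := h0
      rw [commonZeros_zero]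
      ring
    · have h1 := commonZeros_le_one (x₀ := x₀) (x₁ := x₁) (x₂ := x₂) (x₃ := x₃)
        (by simpa [Prod.ext_iff] using h0)
      obtain h1 | h1 := Nat.le_one_iff_eq_zero_or_eq_one.1 h1 <;> simp [h1]
  have hsum := congrArg (Nat.cast : ℕ → ℤ) (sum_commonZeros (F := F))
  push_cast at hsum
  rw [hprod, Finset.sum_congr rfl fun x _ => hpt x, Finset.sum_add_distrib,
    Finset.sum_add_distrib, ← Finset.sum_mul, hsum]
  simp only [Finset.sum_const, Finset.card_univ, Finset.sum_ite_eq', Finset.mem_univ, if_true,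
    Fintype.card_prod, nsmul_eq_mul]
  push_cast
  ring

/-- The value distribution of `orthogonalCount`. -/
theorem sum_comp_orthogonalCount (hk : 8 ≤ k) (h : ℕ → ℤ) :
    ∑ a : Fin k → F, h (orthogonalCount hk a) = (Fintype.card F : ℤ) ^ (k - 8) *
      (h (2 * Fintype.card F)
        + 2 * (Fintype.card F : ℤ) * ((Fintype.card F : ℤ) ^ 2 - 1) * h (Fintype.card F + 1)
        + 2 * ((Fintype.card F : ℤ) ^ 4 - (Fintype.card F : ℤ) ^ 3 + Fintype.card F - 1)
            * h (Fintype.card F)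
        + ((Fintype.card F : ℤ) * ((Fintype.card F : ℤ) ^ 2 - 1)) ^ 2 * h 2
        + 2 * (Fintype.card F : ℤ) * ((Fintype.card F : ℤ) ^ 2 - 1) *
            ((Fintype.card F : ℤ) ^ 4 - (Fintype.card F : ℤ) ^ 3 + Fintype.card F - 1) * h 1
        + ((Fintype.card F : ℤ) ^ 4 - (Fintype.card F : ℤ) ^ 3 + Fintype.card F - 1) ^ 2
            * h 0) := by
  obtain ⟨m, rfl⟩ : ∃ m, k = m + 8 := ⟨k - 8, by omega⟩
  have hrw : ∀ (x₀ x₁ x₂ x₃ x₄ x₅ x₆ x₇ : F) (b : Fin m → F),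
      orthogonalCount hk (Fin.cons x₀ (Fin.cons x₁ (Fin.cons x₂ (Fin.cons x₃ (Fin.cons x₄
        (Fin.cons x₅ (Fin.cons x₆ (Fin.cons x₇ b))))))) : Fin (m + 8) → F) =
      commonZeros x₀ x₁ x₂ x₃ + commonZeros x₄ x₅ x₆ x₇ := fun _ _ _ _ _ _ _ _ _ => rfl
  simp only [sum_fun_succ, hrw, Finset.sum_const, Finset.card_univ, Fintype.card_fun,
    Fintype.card_fin, ← Finset.smul_sum]
  -- The block distribution is applied twice, first to the second block with the first fixed. The
  -- remaining `k - 8` coordinates only contribute a factor.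
  have hinner := fun y => sum_comp_commonZeros (F := F) fun z => h (y + z)
  simp only [hinner]
  rw [sum_comp_commonZeros fun z => h (z + Fintype.card F)
        + (Fintype.card F : ℤ) * ((Fintype.card F : ℤ) ^ 2 - 1) * h (z + 1)
        + ((Fintype.card F : ℤ) ^ 4 - (Fintype.card F : ℤ) ^ 3 + Fintype.card F - 1) * h (z + 0)]
  rw [nsmul_eq_mul, Nat.add_sub_cancel, two_mul (Fintype.card F), add_comm 1 (Fintype.card F)]
  push_cast
  simp only [zero_add, add_zero]
  ring

end Weights

/-! ### Optimality, generalized Hamming weights and the weight distribution -/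

section CodeParameters

open Matrix Finset

theorem le_ceilDiv_of_mul_lt {a b x : ℕ} (hb : 0 < b) (h : b * x < a + b) : x ≤ a ⌈/⌉ b := by
  by_contra! hx
  have h1 : a ≤ b * (a ⌈/⌉ b) := le_smul_ceilDiv hb
  have h2 : b * (a ⌈/⌉ b + 1) ≤ b * x := Nat.mul_le_mul_left b hx
  rw [mul_add, mul_one] at h2
  omega

theorem two_mul_sq_le_pow {q i : ℕ} (hq : 2 ≤ q) : 2 * q ^ 2 ≤ q ^ (i + 3) :=
  calc 2 * q ^ 2 ≤ q * q ^ 2 := Nat.mul_le_mul_right _ hq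
    _ = q ^ 3 := by ring
    _ ≤ q ^ (i + 3) := Nat.pow_le_pow_right (by omega) (by omega)

/-- With `k = m + 3`, the terms `i = 0, 1, 2` are bounded below by `d + 1`, `q^(m+1) - 2q + 1` and
`q^m - 1`. For `i ≥ 3` the deficit `2q^2 - 1` is less than `q^i`, so rounding up recovers
`q^(m+2-i)`. These bounds add up to exactly `n + 1`. -/
theorem lt_sum_ceilDiv {q m n d : ℕ} (hq : 2 ≤ q) (hd : d + 2 * q ^ 2 = q ^ (m + 2))
    (hn : (q - 1) * n + 1 + 2 * q ^ 3 = q ^ (m + 3) + 2 * q) :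
    n < ∑ i ∈ range (m + 3), (d + 1) ⌈/⌉ q ^ i := by
  have hq0 : 0 < q := by omega
  rw [sum_range_succ', sum_range_succ', sum_range_succ']
  have h3 : ∑ j ∈ range m, q ^ j ≤ ∑ i ∈ range m, (d + 1) ⌈/⌉ q ^ (i + 1 + 1 + 1) := by
    rw [← sum_range_reflect]
    refine sum_le_sum fun i hi => le_ceilDiv_of_mul_lt (pow_pos hq0 _) ?_
    have hi := mem_range.1 hi
    rw [← pow_add, show i + 1 + 1 + 1 + (m - 1 - i) = m + 2 by omega, ← hd]
    have := two_mul_sq_le_pow (i := i) hq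
    rw [show i + 1 + 1 + 1 = i + 3 by omega]
    omega
  have h2 : q ^ m - 1 ≤ (d + 1) ⌈/⌉ q ^ (0 + 1 + 1) := by
    refine le_ceilDiv_of_mul_lt (pow_pos hq0 _) ?_
    rw [Nat.mul_sub, ← pow_add, show 0 + 1 + 1 + m = m + 2 by omega, ← hd]
    have := pow_pos hq0 2
    simp only [zero_add, one_add_one_eq_two, mul_one]
    omega
  have hm1 : q ^ (m + 2) = q * q ^ (m + 1) := by ring
  have h1 : q ^ (m + 1) + 1 - 2 * q ≤ (d + 1) ⌈/⌉ q ^ (0 + 1) := by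
    refine le_ceilDiv_of_mul_lt (pow_pos hq0 _) ?_
    rw [zero_add, pow_one, Nat.mul_sub, mul_add, ← hm1, ← hd]
    have : q * (2 * q) = 2 * q ^ 2 := by ring
    omega
  have h0 : (d + 1) ⌈/⌉ q ^ 0 = d + 1 := by simp
  have hle1 : 1 ≤ q ^ m := Nat.one_le_pow _ _ hq0
  have hle2 : 2 * q ≤ q ^ (m + 1) := by
    refine Nat.le_of_mul_le_mul_left ?_ hq0
    rw [← hm1, ← hd]
    nlinarith
  have hgeom := mul_geom_sum (q : ℤ) m
  refine lt_of_lt_of_le ?_ (add_le_add (add_le_add (add_le_add h3 h2) h1) h0.ge)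
  zify [hle1, show 2 * q ≤ q ^ (m + 1) + 1 by omega, show 1 ≤ q by omega] at hd hn ⊢
  have hpos : (0 : ℤ) < (q : ℤ) - 1 := by
    have : (2 : ℤ) ≤ q := by exact_mod_cast hq
    omega
  refine lt_of_mul_lt_mul_left ?_ hpos.le
  have : ((q : ℤ) - 1) * (∑ j ∈ range m, (q : ℤ) ^ j + ((q : ℤ) ^ m - 1)
      + ((q : ℤ) ^ (m + 1) + 1 - 2 * q) + (d + 1)) = ((q : ℤ) - 1) * n + ((q : ℤ) - 1) := by
    linear_combination hgeom - hn + ((q : ℤ) - 1) * hd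
  rw [this]
  linarith

theorem exists_le_finrank_eq {F V : Type*} [Field F] [AddCommGroup V] [Module F V]
    [Module.Finite F V] (W : Submodule F V) {r : ℕ} (h : Module.finrank F W ≤ r)
    (hr : r ≤ Module.finrank F V) : ∃ W' : Submodule F V, W ≤ W' ∧ Module.finrank F W' = r := by
  induction r, h using Nat.le_induction with
  | base => exact ⟨W, le_rfl, rfl⟩
  | succ r _ ih =>
    obtain ⟨W', hW, hr'⟩ := ih (by omega)
    obtain ⟨v, hv⟩ : ∃ v, v ∉ W' := by
      by_contra! hall
      rw [(Submodule.eq_top_iff' (p := W')).2 hall, finrank_top] at hr'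
      omega
    exact ⟨W' ⊔ Submodule.span F {v}, hW.trans le_sup_left,
      by rw [Submodule.finrank_sup_span_singleton hv, hr']⟩

theorem minDist_eq {F : Type*} [Field F] [DecidableEq F] {n : ℕ} {C : Submodule F (Fin n → F)}
    {d : ℕ} (hle : ∀ c ∈ C, c ≠ 0 → d ≤ hammingNorm c)
    (hex : ∃ c ∈ C, c ≠ 0 ∧ hammingNorm c = d) : minDist C = d := by
  obtain ⟨c, hc, hc0, hcd⟩ := hex
  have hmem : d ∈ {d | ∃ a ∈ C, ∃ b ∈ C, a ≠ b ∧ hammingDist a b = d} :=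
    ⟨0, C.zero_mem, c, hc, hc0.symm, by rw [hammingDist_zero_left]; exact hcd⟩
  refine le_antisymm (Nat.sInf_le hmem) (le_csInf ⟨d, hmem⟩ ?_)
  rintro _ ⟨a, ha, b, hb, hab, rfl⟩
  rw [hammingDist_eq_hammingNorm]
  exact hle _ (C.add_mem (C.neg_mem ha) hb) fun h => hab (neg_add_eq_zero.1 h)

theorem minDist_le_hammingNorm {F : Type*} [Field F] [DecidableEq F] {n : ℕ}
    {C : Submodule F (Fin n → F)} {c : Fin n → F} (hc : c ∈ C) (h0 : c ≠ 0) :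
    minDist C ≤ hammingNorm c :=
  Nat.sInf_le ⟨0, C.zero_mem, c, hc, h0.symm, by rw [hammingDist_zero_left]⟩

variable {F : Type*} [Field F] {k n : ℕ} {G : Matrix (Fin k) (Fin n) F}

theorem genHammingWeight_codeOf (hinj : Function.Injective G.vecMulLinear) (r : ℕ) :
    genHammingWeight (codeOf G) r = sInf {m | ∃ W : Submodule F (Fin k → F),
      Module.finrank F W = r ∧ (codeSupport (W.map G.vecMulLinear)).ncard = m} := by
  have hfin : ∀ W : Submodule F (Fin k → F),
      Module.finrank F (W.map G.vecMulLinear) = Module.finrank F W := fun W =>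
    (Submodule.equivMapOfInjective _ hinj W).finrank_eq.symm
  rw [genHammingWeight]
  congr 1
  ext m
  constructor
  · rintro ⟨D, hD, hr, hm⟩
    have hmap := Submodule.map_comap_eq_self hD
    exact ⟨D.comap G.vecMulLinear, by rw [← hfin, hmap, hr], by rw [hmap, hm]⟩
  · rintro ⟨W, hr, hm⟩
    exact ⟨W.map G.vecMulLinear, LinearMap.map_le_range, by rw [hfin, hr], hm⟩

/-- Any `W` containing `e_1 + e_5` and `e_3 + e_7` works: on a plane of either block these two
functionals read off the two coordinates that determine a vector. -/
theorem exists_dotAnnihilator_inf_removedSpace_eq_bot (hk : 8 ≤ k) {r : ℕ} (h2 : 2 ≤ r)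
    (hr : r ≤ k) : ∃ W : Submodule F (Fin k → F), Module.finrank F W = r ∧
      ∀ s, removedSpace F k s ⊓ dotAnnihilator W = ⊥ := by
  let a : Fin k → F := Pi.single ⟨0, by omega⟩ 1 + Pi.single ⟨4, by omega⟩ 1
  let b : Fin k → F := Pi.single ⟨2, by omega⟩ 1 + Pi.single ⟨6, by omega⟩ 1
  have hcard : Module.finrank F (Submodule.span F {a, b}) ≤ 2 := by
    classical
    have := finrank_span_finset_le_card (R := F) ({a, b} : Finset (Fin k → F))
    rw [coe_insert, coe_singleton] at this
    exact this.trans card_le_two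
  obtain ⟨W, hW, hWr⟩ := exists_le_finrank_eq (Submodule.span F {a, b}) (hcard.trans h2)
    (by rwa [Module.finrank_fin_fun])
  refine ⟨W, hWr, fun s => ?_⟩
  rw [eq_bot_iff]
  rintro v ⟨hs, hv⟩
  rw [Submodule.mem_bot]
  have ha := mem_dotAnnihilator.1 hv a (hW (Submodule.subset_span (by simp)))
  have hb := mem_dotAnnihilator.1 hv b (hW (Submodule.subset_span (by simp)))
  simp only [a, b, add_dotProduct, single_dotProduct, one_mul] at ha hb
  rcases s with f | f
  · obtain ⟨-, -, -, h4, h6⟩ := mem_removedSpace_inl hk hs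
    rw [h4, add_zero] at ha
    rw [h6, add_zero] at hb
    exact eq_zero_of_mem_inl hk hs ha hb
  · obtain ⟨-, -, -, h0, h2⟩ := mem_removedSpace_inr hk hs
    rw [h0, zero_add] at ha
    rw [h2, zero_add] at hb
    exact eq_zero_of_mem_inr hk hs ha hb

variable [Fintype F]

theorem PicksRepresentatives.genHammingWeight_eq (hk : 8 ≤ k) (hG : PicksRepresentatives G)
    (hinj : Function.Injective G.vecMulLinear) {r : ℕ} (h2 : 2 ≤ r) (hr : r ≤ k) :
    (Fintype.card F - 1) * genHammingWeight (codeOf G) r + Fintype.card F ^ (k - r)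
        + 2 * Fintype.card F ^ 3 = Fintype.card F ^ k + 2 * Fintype.card F := by
  obtain ⟨W, hWr, hW⟩ := exists_dotAnnihilator_inf_removedSpace_eq_bot (F := F) hk h2 hr
  have hWc := hG.ncard_codeSupport hk hWr
  simp only [hW, Nat.card_unique, sum_const, Finset.card_univ, Fintype.card_sum, smul_eq_mul,
    mul_one, ← two_mul] at hWc
  have hq : 0 < Fintype.card F - 1 := Nat.sub_pos_of_lt Fintype.one_lt_card
  have : genHammingWeight (codeOf G) r = (codeSupport (W.map G.vecMulLinear)).ncard := by
    rw [genHammingWeight_codeOf hinj]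
    refine le_antisymm (Nat.sInf_le ⟨W, hWr, rfl⟩) (le_csInf ⟨_, W, hWr, rfl⟩ ?_)
    rintro _ ⟨W', hr', rfl⟩
    have h' := hG.ncard_codeSupport hk hr'
    -- Each of the `2q` intersections contains at least `0`.
    have hle : 2 * Fintype.card F ≤
        ∑ s, Nat.card ↥(removedSpace F k s ⊓ dotAnnihilator W') := by
      rw [two_mul, ← Fintype.card_sum, Fintype.card_eq_sum_ones]
      exact sum_le_sum fun s _ => Nat.card_pos
    refine Nat.le_of_mul_le_mul_left ?_ hq
    omega
  rw [this, hWc]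

variable [DecidableEq F]

/-- By the weight formula a nonzero message has weight at least `q^(k-1) - 2q^2 > 0`. -/
theorem PicksRepresentatives.vecMulLinear_injective (hk : 8 ≤ k) (hG : PicksRepresentatives G) :
    Function.Injective G.vecMulLinear := by
  rw [← LinearMap.ker_eq_bot, LinearMap.ker_eq_bot']
  intro a ha
  by_contra h0
  have h := hG.hammingNorm_eq hk h0
  rw [vecMulLinear_apply] at ha
  obtain ⟨l, rfl⟩ : ∃ l, k = l + 1 + 3 + 1 := ⟨k - 5, by omega⟩
  have hq : 2 ≤ Fintype.card F := Fintype.one_lt_card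
  have h1 := two_mul_sq_le_pow (i := l) hq
  have h2 : Fintype.card F ^ (l + 3) < Fintype.card F ^ (l + 1 + 3) :=
    Nat.pow_lt_pow_right hq (by omega)
  rw [ha, hammingNorm_zero, Nat.add_sub_cancel] at h
  omega

theorem exists_orthogonalCount_eq_zero (hk : 8 ≤ k) :
    ∃ a : Fin k → F, a ≠ 0 ∧ orthogonalCount hk a = 0 := by
  -- For `e_1 + e_5` each block contains the constant polynomial `1`, which has no root.
  refine ⟨Pi.single ⟨0, by omega⟩ 1 + Pi.single ⟨4, by omega⟩ 1, fun h => ?_, ?_⟩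
  · simpa [Pi.single_apply, Fin.ext_iff] using congrFun h ⟨0, by omega⟩
  · simp [orthogonalCount, commonZeros]

theorem PicksRepresentatives.minDist_codeOf (hk : 8 ≤ k) (hG : PicksRepresentatives G) :
    minDist (codeOf G) + 2 * Fintype.card F ^ 2 = Fintype.card F ^ (k - 1) := by
  obtain ⟨a, ha, hz⟩ := exists_orthogonalCount_eq_zero (F := F) hk
  have hnorm := hG.hammingNorm_eq hk ha
  rw [hz, mul_zero, add_zero] at hnorm
  have hinj := hG.vecMulLinear_injective hk
  have : minDist (codeOf G) = hammingNorm (a ᵥ* G) := by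
    refine minDist_eq ?_ ⟨_, ⟨a, rfl⟩, fun h => ha (hinj (by simpa using h)), rfl⟩
    rintro _ ⟨b, rfl⟩ hb
    have hb0 : b ≠ 0 := fun h => hb (by rw [h, map_zero])
    have := hG.hammingNorm_eq hk hb0
    rw [vecMulLinear_apply]
    omega
  rw [this, hnorm]

theorem PicksRepresentatives.genHammingWeight_one (hk : 8 ≤ k) (hG : PicksRepresentatives G) :
    genHammingWeight (codeOf G) 1 = minDist (codeOf G) := by
  obtain ⟨a, ha, hz⟩ := exists_orthogonalCount_eq_zero (F := F) hk
  have hnorm := hG.hammingNorm_eq hk ha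
  rw [hz, mul_zero, add_zero, ← hG.minDist_codeOf hk] at hnorm
  have hmem : minDist (codeOf G) ∈ {m | ∃ W : Submodule F (Fin k → F),
      Module.finrank F W = 1 ∧ (codeSupport (W.map G.vecMulLinear)).ncard = m} :=
    ⟨_, finrank_span_singleton ha, by rw [← hammingNorm_vecMul]; omega⟩
  have hinj := hG.vecMulLinear_injective hk
  rw [genHammingWeight_codeOf hinj]
  refine le_antisymm (Nat.sInf_le hmem) (le_csInf ⟨_, hmem⟩ ?_)
  rintro _ ⟨W, hW, rfl⟩
  obtain ⟨⟨b, hbW⟩, hb⟩ := Module.finrank_pos_iff_exists_ne_zero.1 (hW ▸ Nat.one_pos)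
  have hb0 : b ≠ 0 := fun h => hb (Subtype.ext h)
  have hspan : Submodule.span F {b} = W := by
    refine Submodule.eq_of_le_of_finrank_eq ((Submodule.span_singleton_le_iff_mem _ _).2 hbW) ?_
    rw [finrank_span_singleton hb0, hW]
  rw [← hspan, ← hammingNorm_vecMul]
  exact minDist_le_hammingNorm ⟨b, rfl⟩ fun h => hb0 (hinj (by simpa using h))

theorem PicksRepresentatives.finrank_codeOf (hk : 8 ≤ k) (hG : PicksRepresentatives G) :
    Module.finrank F (codeOf G) = k := by
  rw [codeOf, LinearMap.finrank_range_of_inj (hG.vecMulLinear_injective hk),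
    Module.finrank_fin_fun]

theorem PicksRepresentatives.isOptimalCode (hk : 8 ≤ k) (hG : PicksRepresentatives G) :
    IsOptimalCode (codeOf G) := by
  rintro ⟨C, hCk, hCd⟩
  rw [hG.finrank_codeOf hk] at hCk
  have hgries := griesmer_bound k hCk
    (fun i : Fin n => LinearMap.proj i ∘ₗ C.subtype) univ (minDist (codeOf G) + 1) (by
      intro v hv
      rw [← hCd]
      exact minDist_le_hammingNorm v.2 fun h => hv (Subtype.ext h))
  obtain ⟨m, rfl⟩ : ∃ m, k = m + 3 := ⟨k - 3, by omega⟩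
  have := lt_sum_ceilDiv Fintype.one_lt_card (hG.minDist_codeOf hk) (hG.card_columns hk)
  rw [Finset.card_univ, Fintype.card_fin] at hgries
  omega

theorem orthogonalCount_zero (hk : 8 ≤ k) :
    orthogonalCount hk (0 : Fin k → F) = 2 * Fintype.card F := by
  simp [orthogonalCount, commonZeros_zero, two_mul]

/-- The weight formula fails only at `a = 0`, where `N = 2q` would give `q^(k-1)` instead of `0`.
The last two terms correct this; hence the `-1` in the row `q^(k-1)`. -/
theorem PicksRepresentatives.weightCount_codeOf (hk : 8 ≤ k) (hG : PicksRepresentatives G)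
    (w : ℕ) :
    (weightCount (codeOf G) w : ℤ) =
      (∑ a : Fin k → F, if (w : ℤ) = (Fintype.card F : ℤ) ^ (k - 1) - 2 * (Fintype.card F : ℤ) ^ 2
          + Fintype.card F * orthogonalCount hk a then 1 else 0)
        + (if (w : ℤ) = 0 then 1 else 0)
        - (if (w : ℤ) = (Fintype.card F : ℤ) ^ (k - 1) then 1 else 0) := by
  have hinj := hG.vecMulLinear_injective hk
  have himage : {c : Fin n → F | c ∈ codeOf G ∧ hammingNorm c = w} =
      G.vecMulLinear '' (({a | hammingNorm (a ᵥ* G) = w} : Finset (Fin k → F)) : Set _) := by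
    ext c
    constructor
    · rintro ⟨⟨a, rfl⟩, h⟩
      exact ⟨a, by simpa using h, rfl⟩
    · rintro ⟨a, h, rfl⟩
      exact ⟨⟨a, rfl⟩, by simpa using h⟩
  have hpt : ∀ a : Fin k → F, (if hammingNorm (a ᵥ* G) = w then (1 : ℤ) else 0) =
      (if (w : ℤ) = (Fintype.card F : ℤ) ^ (k - 1) - 2 * (Fintype.card F : ℤ) ^ 2
          + Fintype.card F * orthogonalCount hk a then 1 else 0)
        + (if a = 0 then (if (w : ℤ) = 0 then 1 else 0)
            - (if (w : ℤ) = (Fintype.card F : ℤ) ^ (k - 1) then 1 else 0) else 0) := by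
    intro a
    by_cases ha : a = 0
    · subst ha
      have h1 : (Fintype.card F : ℤ) ^ (k - 1) - 2 * (Fintype.card F : ℤ) ^ 2
          + Fintype.card F * (2 * Fintype.card F : ℕ) = (Fintype.card F : ℤ) ^ (k - 1) := by
        push_cast
        ring
      rw [orthogonalCount_zero, h1, zero_vecMul, hammingNorm_zero, if_pos rfl]
      simp [eq_comm (a := 0)]
    · have h1 := congrArg (Nat.cast : ℕ → ℤ) (hG.hammingNorm_eq hk ha)
      push_cast at h1
      rw [if_neg ha, add_zero]
      refine if_congr ?_ rfl rfl
      rw [← Nat.cast_inj (R := ℤ), eq_comm, eq_sub_of_add_eq h1, add_sub_right_comm]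
  rw [weightCount, himage, Set.ncard_image_of_injective _ hinj, Set.ncard_coe_finset, card_filter]
  push_cast
  rw [sum_congr rfl fun a _ => hpt a, sum_add_distrib]
  simp only [sum_ite_eq', mem_univ, if_true]
  ring

end CodeParameters

theorem theorem2p5 {F : Type*} [Field F] [Fintype F] [DecidableEq F]
    (q : ℕ) (hq : Fintype.card F = q) (k : ℕ) (hk : 8 ≤ k) :
    (∀ s, Module.finrank F (removedSpace F k s) = 2) ∧
    (∀ s t, s ≠ t → removedSpace F k s ⊓ removedSpace F k t = ⊥) ∧
    (∃ (n : ℕ) (G : Matrix (Fin k) (Fin n) F), PicksRepresentatives G) ∧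
    ∀ (n : ℕ) (G : Matrix (Fin k) (Fin n) F), PicksRepresentatives G →
      (n : ℚ) = (((q : ℚ) ^ k - 1) - 2 * q * ((q : ℚ) ^ 2 - 1)) / ((q : ℚ) - 1) ∧
      Module.finrank F (codeOf G) = k ∧
      (minDist (codeOf G) : ℤ) = (q : ℤ) ^ (k - 1) - 2 * (q : ℤ) ^ 2 ∧
      IsOptimalCode (codeOf G) ∧
      (∀ w : ℕ, (weightCount (codeOf G) w : ℤ) =
        (if (w : ℤ) = 0 then 1 else 0)
        + (if (w : ℤ) = (q : ℤ) ^ (k - 1) then (q : ℤ) ^ (k - 8) - 1 else 0)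
        + (if (w : ℤ) = (q : ℤ) ^ (k - 1) - (q : ℤ) ^ 2 + q then
            2 * q * ((q : ℤ) ^ 2 - 1) * (q : ℤ) ^ (k - 8) else 0)
        + (if (w : ℤ) = (q : ℤ) ^ (k - 1) - (q : ℤ) ^ 2 then
            2 * ((q : ℤ) ^ 4 - (q : ℤ) ^ 3 + q - 1) * (q : ℤ) ^ (k - 8) else 0)
        + (if (w : ℤ) = (q : ℤ) ^ (k - 1) - 2 * (q : ℤ) ^ 2 + 2 * q then
            ((q : ℤ) ^ 2 - 1) ^ 2 * (q : ℤ) ^ (k - 6) else 0)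
        + (if (w : ℤ) = (q : ℤ) ^ (k - 1) - 2 * (q : ℤ) ^ 2 + q then
            2 * q * ((q : ℤ) ^ 2 - 1) * ((q : ℤ) ^ 4 - (q : ℤ) ^ 3 + q - 1) * (q : ℤ) ^ (k - 8)
            else 0)
        + (if (w : ℤ) = (q : ℤ) ^ (k - 1) - 2 * (q : ℤ) ^ 2 then
            ((q : ℤ) ^ 4 - (q : ℤ) ^ 3 + q - 1) ^ 2 * (q : ℤ) ^ (k - 8) else 0)) ∧
      (genHammingWeight (codeOf G) 1 : ℤ) = (q : ℤ) ^ (k - 1) - 2 * (q : ℤ) ^ 2 ∧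
      (∀ r : ℕ, 2 ≤ r → r ≤ k →
        (genHammingWeight (codeOf G) r : ℚ) =
          (((q : ℚ) ^ k - (q : ℚ) ^ (k - r)) - 2 * q * ((q : ℚ) ^ 2 - 1)) / ((q : ℚ) - 1)) := by
  subst hq
  refine ⟨finrank_removedSpace hk, removedSpace_inf_eq_bot hk, exists_picksRepresentatives, ?_⟩
  intro n G hG
  have hq1 : 1 ≤ Fintype.card F := Fintype.card_pos
  have hq : (Fintype.card F : ℚ) - 1 ≠ 0 := by
    rw [sub_ne_zero]
    exact_mod_cast (Fintype.one_lt_card (α := F)).ne'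
  have hdist : (minDist (codeOf G) : ℤ) =
      (Fintype.card F : ℤ) ^ (k - 1) - 2 * (Fintype.card F : ℤ) ^ 2 := by
    have h := congrArg (Nat.cast : ℕ → ℤ) (hG.minDist_codeOf hk)
    push_cast at h
    linear_combination h
  refine ⟨?_, hG.finrank_codeOf hk, hdist, hG.isOptimalCode hk, ?_, ?_, ?_⟩
  · have h := congrArg (Nat.cast : ℕ → ℚ) (hG.card_columns hk)
    push_cast [hq1] at h
    rw [eq_div_iff hq]
    linear_combination h
  · intro w
    rw [hG.weightCount_codeOf hk]
    -- Treating the indicator of `w` as an opaque function turns the table into a polynomial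
    -- identity, with no case split on coinciding weights.
    obtain ⟨δ, hδ⟩ : ∃ δ : ℤ → ℤ, ∀ t x : ℤ, (if (w : ℤ) = t then x else 0) = x * δ t :=
      ⟨fun t => if (w : ℤ) = t then 1 else 0, fun t x => by simp⟩
    simp only [hδ]
    have hsum := sum_comp_orthogonalCount (F := F) hk fun z => 1 *
      δ ((Fintype.card F : ℤ) ^ (k - 1) - 2 * (Fintype.card F : ℤ) ^ 2 + Fintype.card F * z)
    rw [hsum]
    generalize hQ : (Fintype.card F : ℤ) = Q
    have hpow : Q ^ (k - 6) = Q ^ (k - 8) * Q ^ 2 := by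
      rw [← pow_add]
      congr 1
      omega
    push_cast
    rw [hQ, hpow,
      show Q ^ (k - 1) - 2 * Q ^ 2 + Q * (2 * Q) = Q ^ (k - 1) by ring,
      show Q ^ (k - 1) - 2 * Q ^ 2 + Q * (Q + 1) = Q ^ (k - 1) - Q ^ 2 + Q by ring,
      show Q ^ (k - 1) - 2 * Q ^ 2 + Q * Q = Q ^ (k - 1) - Q ^ 2 by ring,
      show Q ^ (k - 1) - 2 * Q ^ 2 + Q * 2 = Q ^ (k - 1) - 2 * Q ^ 2 + 2 * Q by ring,
      show Q ^ (k - 1) - 2 * Q ^ 2 + Q * 1 = Q ^ (k - 1) - 2 * Q ^ 2 + Q by ring,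
      show Q ^ (k - 1) - 2 * Q ^ 2 + Q * 0 = Q ^ (k - 1) - 2 * Q ^ 2 by ring]
    generalize Q ^ (k - 1) = A
    ring
  · rw [hG.genHammingWeight_one hk, hdist]
  · intro r h2 hr
    have h := congrArg (Nat.cast : ℕ → ℚ)
      (hG.genHammingWeight_eq hk (hG.vecMulLinear_injective hk) h2 hr)
    push_cast [hq1] at h
    rw [eq_div_iff hq]
    linear_combination h
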